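/- Let $G=(V,E)$ be a finite connected multigraph: parallel edges are allowed, loops are not, and each edge $e$ has endpoints $e^+,e^-\in V$ with respect to an arbitrary fixed orientation. Let $\kappa(G)$ be the number of spanning trees of $G$, and let $\kappa_2(G)$ be the number of two-forests of $G$, that is, of subgraphs that contain all vertices, contain no cycle, and have exactly two connected components. Let $r(x,y)$ be the effective resistance between $x,y\in V$ when each edge of $G$ is a unit resistor: $r(x,y)=\varphi(x)-\varphi(y)$ for any $\varphi\colon V\to\mathbb{R}$ with $L\varphi=\delta_x-\delta_y$, where $L$ is the Laplacian matrix of $G$. Then $\kappa(G)>0$, and for every vertex $q\in V$ $$\frac{\kappa_2(G)}{\kappa(G)}=\frac14\sum_{e\in E} r(e^+,e^-)^2+\frac34\sum_{e\in E}\bigl(r(e^+,q)-r(e^-,q)\bigr)^2 .$$ Equivalently, the gamma constant $\gamma(G)=\frac14\sum_{e\in E}\bigl(r(e^+,q)-r(e^-,q)\bigr)^2$ does not depend on the choice of the vertex $q$, and $$\frac{\kappa_2(G)}{\kappa(G)}=3\,\gamma(G)+\frac14\sum_{e\in E} r(e^+,e^-)^2 .$$ -/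

import Mathlib

/-- An oriented multigraph with vertex set `V` and edge set `E`: each edge `e` has endpoints
`head e` and `tail e`. Parallel edges are allowed, loops are not. -/
structure Multigraph (V E : Type*) where
  /-- The endpoint `e⁺`. -/
  head : E → V
  /-- The endpoint `e⁻`. -/
  tail : E → V
  /-- There are no loop edges. -/
  head_ne_tail : ∀ e, head e ≠ tail e

namespace Multigraph

section Basic

variable {V E : Type*}

/-- The edge `e` has endpoints `x` and `y` (in either orientation). -/
def Joins (G : Multigraph V E) (e : E) (x y : V) : Prop :=
  (G.head e = x ∧ G.tail e = y) ∨ (G.head e = y ∧ G.tail e = x)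

/-- The adjacency relation of the spanning subgraph of `G` with edge set `F` (all vertices of `G`,
and the edges in `F`). It determines reachability and connected components of that subgraph. -/
def adjacency (G : Multigraph V E) (F : Set E) : SimpleGraph V where
  Adj x y := ∃ e ∈ F, G.Joins e x y
  symm := ⟨by
    rintro x y ⟨e, he, h⟩
    exact ⟨e, he, h.symm⟩⟩
  loopless := ⟨by
    rintro x ⟨e, -, h⟩
    rcases h with ⟨h1, h2⟩ | ⟨h1, h2⟩ <;> exact G.head_ne_tail e (h1.trans h2.symm)⟩

/-- `G` is connected (in particular it has a vertex). -/
def Connected (G : Multigraph V E) : Prop :=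
  (G.adjacency Set.univ).Connected

/-- The spanning subgraph with edge set `F` contains a cycle: distinct vertices `v 0, …, v n` and
distinct edges `c 0, …, c n` of `F` such that `c i` joins `v i` to `v (i + 1)`, where the indices
are taken cyclically. Two parallel edges form a cycle (`n = 1`). -/
def HasCycle (G : Multigraph V E) (F : Set E) : Prop :=
  ∃ (n : ℕ) (v : Fin (n + 1) → V) (c : Fin (n + 1) → E),
    Function.Injective v ∧ Function.Injective c ∧
      ∀ i, c i ∈ F ∧ G.Joins (c i) (v i) (v (i + 1))

/-- `F` is the edge set of an `r`-forest: a spanning subgraph that contains no cycle and has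
exactly `r` connected components. -/
def IsForest (G : Multigraph V E) (r : ℕ) (F : Set E) : Prop :=
  ¬ G.HasCycle F ∧ Nat.card (G.adjacency F).ConnectedComponent = r

/-- The number `κ_r(G)` of `r`-forests of `G`. Thus `κ_1(G) = κ(G)` is the number of spanning
trees and `κ_2(G)` is the number of two-forests. -/
noncomputable def kappa (G : Multigraph V E) (r : ℕ) : ℕ :=
  {F : Set E | G.IsForest r F}.ncard

end Basic

section Resistance

variable {V E : Type*} [Fintype V] [DecidableEq V] [Fintype E]

/-- The signed incidence matrix of `G`. -/
def incidence (G : Multigraph V E) : Matrix V E ℝ :=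
  Matrix.of fun v e => if v = G.head e then 1 else if v = G.tail e then -1 else 0

/-- The Laplacian matrix of `G`. -/
def laplacian (G : Multigraph V E) : Matrix V V ℝ :=
  G.incidence * G.incidence.transpose

/-- `φ` is an electric potential on the network with a unit resistor on each edge when one unit of
current enters at `x` and exits at `y`: by Ohm's law the current through `e` from `e⁺` to `e⁻` is
`φ e⁺ - φ e⁻`, so the net current leaving `v` along the edges is the entry of `L φ` at `v`. -/
def IsUnitPotential (G : Multigraph V E) (x y : V) (φ : V → ℝ) : Prop :=
  G.laplacian.mulVec φ = Pi.single x 1 - Pi.single y 1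

open Classical in
/-- The effective resistance between `x` and `y`: the potential difference between `x` and `y`
when one unit of current enters the network at `x` and exits at `y`. -/
noncomputable def effRes (G : Multigraph V E) (x y : V) : ℝ :=
  if h : ∃ φ, G.IsUnitPotential x y φ then h.choose x - h.choose y else 0

/-- The sum `(1/4) ∑_e (r(e⁺,q) - r(e⁻,q))²` that defines the gamma constant of `G`, formed with
the base vertex `q`. -/
noncomputable def gammaConst (G : Multigraph V E) (q : V) : ℝ :=
  1 / 4 * ∑ e : E, (G.effRes (G.head e) q - G.effRes (G.tail e) q) ^ 2

/-- The effective resistance does not depend on the choice of the potential. -/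
theorem IsUnitPotential.effRes_eq {G : Multigraph V E} {x y : V} {φ : V → ℝ}
    (hφ : G.IsUnitPotential x y φ) : G.effRes x y = φ x - φ y := by
  have h : ∃ φ, G.IsUnitPotential x y φ := ⟨φ, hφ⟩
  have key : ∀ ψ χ : V → ℝ, G.IsUnitPotential x y ψ → dotProduct χ (G.laplacian.mulVec ψ)
      = χ x - χ y := by
    intro ψ χ hψ
    rw [hψ, dotProduct_sub]
    simp
  have hsymm : G.laplacian.transpose = G.laplacian := by
    simp [laplacian, Matrix.transpose_mul]
  rw [effRes, dif_pos h, ← key φ _ hφ, ← key _ φ h.choose_spec, Matrix.dotProduct_mulVec,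
    ← Matrix.mulVec_transpose, hsymm, dotProduct_comm]

/-- In a connected graph a unit potential exists, so the effective resistance is the potential
difference and not a default value. -/
theorem Connected.exists_isUnitPotential {G : Multigraph V E} (hG : G.Connected) (x y : V) :
    ∃ φ, G.IsUnitPotential x y φ := by
  have hB : ∀ (χ : V → ℝ) (e : E), G.incidence.transpose.mulVec χ e
      = χ (G.head e) - χ (G.tail e) := by
    intro χ e
    have h1 : ∀ v, G.incidence v e
        = (if v = G.head e then (1 : ℝ) else 0) - (if v = G.tail e then 1 else 0) := by
      intro v
      have := G.head_ne_tail e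
      simp only [incidence, Matrix.of_apply]
      split_ifs <;> simp_all
    simp [Matrix.mulVec, dotProduct, h1, sub_mul, Finset.sum_sub_distrib]
  have hq : ∀ χ : V → ℝ, dotProduct χ (G.laplacian.mulVec χ)
      = ∑ e, (χ (G.head e) - χ (G.tail e)) ^ 2 := by
    intro χ
    rw [laplacian, ← Matrix.mulVec_mulVec, Matrix.dotProduct_mulVec, ← Matrix.mulVec_transpose]
    simp only [dotProduct, hB, sq]
  have hone : ∀ χ : V → ℝ, ∑ v, G.laplacian.mulVec χ v = 0 := by
    intro χ
    have : dotProduct (fun _ => (1 : ℝ)) (G.laplacian.mulVec χ) = 0 := by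
      rw [laplacian, ← Matrix.mulVec_mulVec, Matrix.dotProduct_mulVec, ← Matrix.mulVec_transpose]
      simp [dotProduct, hB]
    simpa [dotProduct] using this
  let M : (V → ℝ) →ₗ[ℝ] (V → ℝ) :=
    { toFun := fun χ v => G.laplacian.mulVec χ v + ∑ w, χ w
      map_add' := by
        intro a b
        ext v
        simp [Matrix.mulVec_add, Finset.sum_add_distrib]
        ring
      map_smul' := by
        intro a b
        ext v
        simp [Matrix.mulVec_smul, ← Finset.mul_sum]
        ring }
  have hinj : Function.Injective M := by
    rw [← LinearMap.ker_eq_bot, LinearMap.ker_eq_bot']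
    intro χ hχ
    have h0 : ∑ v, χ v * M χ v = 0 := by simp [hχ]
    have h1 : ∑ e, (χ (G.head e) - χ (G.tail e)) ^ 2 + (∑ w, χ w) ^ 2 = 0 := by
      rw [← h0, ← hq]
      simp only [M, LinearMap.coe_mk, AddHom.coe_mk, mul_add, Finset.sum_add_distrib, dotProduct,
        ← Finset.sum_mul, sq]
    have h2 : ∑ e, (χ (G.head e) - χ (G.tail e)) ^ 2 = 0 := by
      have := Finset.sum_nonneg (s := Finset.univ)
        (fun e (_ : e ∈ Finset.univ) => sq_nonneg (χ (G.head e) - χ (G.tail e)))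
      nlinarith [sq_nonneg (∑ w, χ w)]
    have h3 : ∑ w, χ w = 0 := by
      rw [h2, zero_add] at h1
      exact pow_eq_zero_iff (two_ne_zero) |>.1 h1
    have h4 : ∀ e, χ (G.head e) = χ (G.tail e) := by
      intro e
      have := (Finset.sum_eq_zero_iff_of_nonneg (fun e _ => sq_nonneg _)).1 h2 e
        (Finset.mem_univ e)
      exact sub_eq_zero.1 (pow_eq_zero_iff (two_ne_zero) |>.1 this)
    have h5 : ∀ a b, χ a = χ b := by
      intro a b
      obtain ⟨p⟩ := hG.preconnected a b
      induction p with
      | nil => rfl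
      | cons h _ ih =>
        obtain ⟨e, -, h⟩ := h
        rw [← ih]
        rcases h with ⟨h1, h2⟩ | ⟨h1, h2⟩
        · rw [← h1, ← h2, h4]
        · rw [← h1, ← h2, h4]
    funext a
    have h6 : ∑ w, χ w = Fintype.card V * χ a := by
      rw [Finset.sum_congr rfl (fun w _ => h5 w a)]
      simp
    have h7 : (Fintype.card V : ℝ) ≠ 0 := by
      have : Nonempty V := ⟨a⟩
      exact_mod_cast Fintype.card_ne_zero
    rw [h3] at h6
    simpa [h7] using h6.symm
  obtain ⟨φ, hφ⟩ := (LinearMap.injective_iff_surjective.1 hinj) (Pi.single x 1 - Pi.single y 1)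
  have hv : ∀ v, G.laplacian.mulVec φ v + ∑ w, φ w
      = (Pi.single x 1 - Pi.single y 1 : V → ℝ) v := fun v => congrFun hφ v
  have hs : (Fintype.card V : ℝ) * ∑ w, φ w = 0 := by
    have h1 : ∑ v, (G.laplacian.mulVec φ v + ∑ w, φ w)
        = ∑ v, (Pi.single x 1 - Pi.single y 1 : V → ℝ) v :=
      Finset.sum_congr rfl fun v _ => hv v
    rw [Finset.sum_add_distrib, hone] at h1
    simpa using h1
  have h7 : (Fintype.card V : ℝ) ≠ 0 := by
    have : Nonempty V := ⟨x⟩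
    exact_mod_cast Fintype.card_ne_zero
  have h8 : ∑ w, φ w = 0 := (mul_eq_zero.1 hs).resolve_left h7
  refine ⟨φ, ?_⟩
  funext v
  simpa [h8] using hv v

end Resistance

end Multigraph

namespace Multigraph

/-! ### Edge sets that connect every vertex to a root set. -/

section Spanning

variable {V E : Type*}

/-! Fix `q`. In a two-forest the component avoiding `q` is a tree, so it has one more vertex than
edges. Summing this 1 over all two-forests gives κ₂ = ∑_v #{two-forests separating v from q} − ∑_e
#{two-forests containing e outside the component of q} (`kappa_two_add_sum`).

Both counts are determinants. The same deletion-contraction recursion holds for forests and for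
determinants, so the Laplacian grounded at `S` has as determinant the number of spanning forests
with exactly one vertex of `S` in each component (`det_groundedLaplacian`). Let g be the Green
function grounded at `q`. Cramer's rule turns the first count into κ g(v,v) and, after contracting e
= xy, the second into κ (g(x,x) g(y,y) − g(x,y)²).

Finally L g_v = δ_v − δ_q spreads ∑_v g(v,v) over the edges (`IsGreen.sum_apply_self`). Since r(x,q)
= g(x,x) and r(x,y) = g(x,x) + g(y,y) − 2g(x,y), the formula becomes a polynomial identity for each
edge. The gamma constant is then independent of `q` because every other term is. -/

theorem Joins.symm {G : Multigraph V E} {e : E} {x y : V} (h : G.Joins e x y) : G.Joins e y x :=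
  Or.symm h

theorem joins_head_tail (G : Multigraph V E) (e : E) : G.Joins e (G.head e) (G.tail e) :=
  Or.inl ⟨rfl, rfl⟩

theorem Joins.ne {G : Multigraph V E} {e : E} {x y : V} (h : G.Joins e x y) : x ≠ y := by
  have := G.head_ne_tail e
  rcases h with ⟨rfl, rfl⟩ | ⟨rfl, rfl⟩
  · exact this
  · exact this.symm

/-- The endpoints of an edge are determined up to order. -/
theorem Joins.eq_or_eq {G : Multigraph V E} {e : E} {x y a b : V} (h : G.Joins e x y)
    (h' : G.Joins e a b) : (a = x ∧ b = y) ∨ (a = y ∧ b = x) := by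
  rcases h with ⟨rfl, rfl⟩ | ⟨rfl, rfl⟩ <;> rcases h' with ⟨rfl, rfl⟩ | ⟨rfl, rfl⟩ <;> simp

theorem Joins.reachable {G : Multigraph V E} {F : Set E} {e : E} {x y : V} (h : G.Joins e x y)
    (he : e ∈ F) : (G.adjacency F).Reachable x y :=
  SimpleGraph.Adj.reachable ⟨e, he, h⟩

theorem adjacency_mono (G : Multigraph V E) {F F' : Set E} (h : F ⊆ F') :
    G.adjacency F ≤ G.adjacency F' := by
  rintro x y ⟨e, he, hj⟩
  exact ⟨e, h he, hj⟩

/-- A set of vertices that is closed under the edges of `F` is closed under reachability. -/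
theorem of_reachable {G : Multigraph V E} {F : Set E} {p : V → Prop}
    (hp : ∀ e ∈ F, ∀ a b, G.Joins e a b → p a → p b) {x y : V}
    (h : (G.adjacency F).Reachable x y) (hx : p x) : p y := by
  obtain ⟨w⟩ := h
  induction w with
  | nil => exact hx
  | cons h _ ih =>
    obtain ⟨e, he, h⟩ := h
    exact ih (hp e he _ _ h hx)

/-- Every vertex is joined to `S` by a path in `F`. -/
def Spans (G : Multigraph V E) (F : Set E) (S : Set V) : Prop :=
  ∀ v, ∃ s ∈ S, (G.adjacency F).Reachable s v

/-- A path that used `e` can restart at the far end of `e`, since both ends are now roots. Making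
`y` a root plays the role of contracting `e`. -/
theorem Spans.diff_insert {G : Multigraph V E} {F : Set E} {S : Set V} {e : E} {s y : V}
    (h : G.Spans F S) (he : G.Joins e s y) (hs : s ∈ S) : G.Spans (F \ {e}) (insert y S) := by
  intro v
  obtain ⟨t, ht, hr⟩ := h v
  refine of_reachable (p := fun w => ∃ s ∈ insert y S, (G.adjacency (F \ {e})).Reachable s w)
    ?_ hr ⟨t, Or.inr ht, .refl _⟩
  rintro e' he' a b hj ⟨u, hu, hua⟩
  by_cases hee : e' = e
  · subst hee
    rcases he.eq_or_eq hj with ⟨-, rfl⟩ | ⟨-, rfl⟩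
    · exact ⟨b, Or.inl rfl, .refl _⟩
    · exact ⟨b, Or.inr hs, .refl _⟩
  · exact ⟨u, hu, hua.trans (hj.reachable ⟨he', hee⟩)⟩

theorem Spans.insert_edge {G : Multigraph V E} {F : Set E} {S : Set V} {e : E} {s y : V}
    (h : G.Spans F (insert y S)) (he : G.Joins e s y) (hs : s ∈ S) : G.Spans (insert e F) S := by
  intro v
  obtain ⟨t, ht, hr⟩ := h v
  have hr' := hr.mono (G.adjacency_mono (Set.subset_insert e F))
  rcases ht with rfl | ht
  · exact ⟨s, hs, (he.reachable (Set.mem_insert e F)).trans hr'⟩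
  · exact ⟨t, ht, hr'⟩

/-- If `F` joins every vertex to `S` and no edge of `F` leaves `S`, then `S` is everything. -/
theorem Spans.mem_of_closed {G : Multigraph V E} {F : Set E} {S : Set V} (h : G.Spans F S)
    (hc : ∀ e ∈ F, ∀ s y, G.Joins e s y → s ∈ S → y ∈ S) (v : V) : v ∈ S := by
  obtain ⟨s, hs, hr⟩ := h v
  exact of_reachable hc hr hs

end Spanning

/-! ### Rooted forests and deletion-contraction. -/

section Rooted

variable {V E : Type*} [Fintype V]

open Classical in
/-- Induction on a finite edge set by removing an edge that leaves the root set and adding its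
outer endpoint to the roots. -/
theorem root_induction (G : Multigraph V E) {P : Finset V → Finset E → Prop}
    (closed : ∀ S F, (∀ e ∈ F, ∀ s y, G.Joins e s y → s ∈ S → y ∈ S) → P S F)
    (step : ∀ S F e s y, e ∈ F → G.Joins e s y → s ∈ S → y ∉ S → P S (F.erase e) →
      P (insert y S) (F.erase e) → P S F) (S : Finset V) (F : Finset E) : P S F := by
  induction hn : F.card generalizing S F with
  | zero =>
    rw [Finset.card_eq_zero] at hn
    exact closed S F (by simp [hn])
  | succ n ih =>
    by_cases hc : ∀ e ∈ F, ∀ s y, G.Joins e s y → s ∈ S → y ∈ S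
    · exact closed S F hc
    · push Not at hc
      obtain ⟨e, he, s, y, hj, hs, hy⟩ := hc
      have : (F.erase e).card = n := by rw [Finset.card_erase_of_mem he, hn]; rfl
      exact step S F e s y he hj hs hy (ih S _ this) (ih _ _ this)

/-- Each step of the root induction trades one edge for one root, until every vertex is a root.
Rooted forests are the case of equality. -/
theorem Spans.card_le {G : Multigraph V E} {F : Finset E} {S : Finset V}
    (h : G.Spans (F : Set E) (S : Set V)) : Fintype.card V ≤ F.card + S.card := by
  classical
  revert h
  refine root_induction G (P := fun S F => G.Spans (F : Set E) (S : Set V) →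
    Fintype.card V ≤ F.card + S.card) ?_ ?_ S F
  · intro S F hc h
    have : S = Finset.univ := Finset.eq_univ_iff_forall.2 fun v => h.mem_of_closed hc v
    simp [this]
  · intro S F e s y he hj hs hy _ ih h
    have h1 := ih (by simpa using h.diff_insert hj hs)
    rw [Finset.card_erase_of_mem he, Finset.card_insert_of_notMem hy] at h1
    have := Finset.card_pos.2 ⟨e, he⟩
    omega

open Classical in
/-- The edge sets `T ⊆ F` of the spanning forests in which every component contains exactly one
vertex of `S`. -/
noncomputable def rootedForests (G : Multigraph V E) (S : Finset V) (F : Finset E) :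
    Finset (Finset E) :=
  {T ∈ F.powerset | T.card + S.card = Fintype.card V ∧ G.Spans (T : Set E) (S : Set V)}

theorem mem_rootedForests {G : Multigraph V E} {S : Finset V} {F T : Finset E} :
    T ∈ G.rootedForests S F ↔
      T ⊆ F ∧ T.card + S.card = Fintype.card V ∧ G.Spans (T : Set E) (S : Set V) := by
  simp [rootedForests]

open Classical in
/-- The rooted forests through an edge that leaves the root set. -/
theorem card_rootedForests_mem (G : Multigraph V E) {S : Finset V} {F : Finset E} {e : E} {s y : V}
    (he : e ∈ F) (hj : G.Joins e s y) (hs : s ∈ S) (hy : y ∉ S) :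
    ({T ∈ G.rootedForests S F | e ∈ T}).card
      = (G.rootedForests (insert y S) (F.erase e)).card := by
  refine Finset.card_bij' (fun T _ => T.erase e) (fun T _ => insert e T) ?_ ?_ ?_ ?_
  · intro T hT
    rw [Finset.mem_filter, mem_rootedForests] at hT
    obtain ⟨⟨hTF, hc, hsp⟩, heT⟩ := hT
    rw [mem_rootedForests]
    refine ⟨Finset.erase_subset_erase e hTF, ?_, by simpa using hsp.diff_insert hj hs⟩
    rw [Finset.card_erase_of_mem heT, Finset.card_insert_of_notMem hy]
    have := Finset.card_pos.2 ⟨e, heT⟩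
    omega
  · intro T hT
    rw [mem_rootedForests] at hT
    obtain ⟨hTF, hc, hsp⟩ := hT
    have heT : e ∉ T := fun h => by simpa using hTF h
    rw [Finset.mem_filter, mem_rootedForests]
    refine ⟨⟨?_, ?_, ?_⟩, Finset.mem_insert_self e T⟩
    · rw [Finset.insert_subset_iff]
      exact ⟨he, hTF.trans (Finset.erase_subset e F)⟩
    · rw [Finset.card_insert_of_notMem hy] at hc
      rw [Finset.card_insert_of_notMem heT]
      omega
    · rw [Finset.coe_insert] at hsp ⊢
      exact hsp.insert_edge hj hs
  · intro T hT
    exact Finset.insert_erase (Finset.mem_filter.1 hT).2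
  · intro T hT
    exact Finset.erase_insert fun h => by simpa using (mem_rootedForests.1 hT).1 h

-- Deletion-contraction: a forest either avoids `e`, or loses `e` and gains the root `y`.
open Classical in
theorem card_rootedForests_step (G : Multigraph V E) {S : Finset V} {F : Finset E} {e : E}
    {s y : V} (he : e ∈ F) (hj : G.Joins e s y) (hs : s ∈ S) (hy : y ∉ S) :
    (G.rootedForests S F).card = (G.rootedForests S (F.erase e)).card
      + (G.rootedForests (insert y S) (F.erase e)).card := by
  rw [← card_rootedForests_mem G he hj hs hy,
    ← Finset.card_filter_add_card_filter_not (s := G.rootedForests S F) (fun T => e ∈ T), add_comm]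
  congr 2
  ext T
  simp only [Finset.mem_filter, mem_rootedForests, Finset.subset_erase]
  tauto

open Classical in
/-- In a spanning set of edges there is a rooted forest. -/
theorem Spans.card_rootedForests_pos {G : Multigraph V E} {F : Finset E} {S : Finset V}
    (h : G.Spans (F : Set E) (S : Set V)) : 0 < (G.rootedForests S F).card := by
  revert h
  refine root_induction G (P := fun S F => G.Spans (F : Set E) (S : Set V) →
    0 < (G.rootedForests S F).card) ?_ ?_ S F
  · intro S F hc h
    have hS : ∀ v, v ∈ S := fun v => h.mem_of_closed hc v
    refine Finset.card_pos.2 ⟨∅, mem_rootedForests.2 ⟨by simp, ?_, fun v => ⟨v, hS v, .refl _⟩⟩⟩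
    rw [Finset.eq_univ_iff_forall.2 hS]
    simp
  · intro S F e s y he hj hs hy _ ih h
    rw [card_rootedForests_step G he hj hs hy]
    have := ih (by simpa using h.diff_insert hj hs)
    omega

end Rooted

/-! ### The matrix-tree theorem for grounded Laplacians. -/

section Determinant

variable {V E : Type*} [DecidableEq V]

theorem incidence_apply (G : Multigraph V E) (v : V) (e : E) : G.incidence v e
    = (if v = G.head e then (1 : ℝ) else 0) - (if v = G.tail e then 1 else 0) := by
  have := G.head_ne_tail e
  simp only [incidence, Matrix.of_apply]
  split_ifs <;> simp_all

theorem Joins.incidence_mul {G : Multigraph V E} {e : E} {s y : V}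
    (h : G.Joins e s y) (w : V) : G.incidence y e * G.incidence w e
      = (Pi.single y 1 - Pi.single s 1 : V → ℝ) w := by
  have := h.ne
  simp only [incidence_apply, Pi.sub_apply, Pi.single_apply]
  rcases h with ⟨rfl, rfl⟩ | ⟨rfl, rfl⟩ <;> simp [this.symm]

theorem Joins.incidence_eq_zero {G : Multigraph V E} {e : E} {s y v : V}
    (h : G.Joins e s y) (hs : v ≠ s) (hy : v ≠ y) : G.incidence v e = 0 := by
  rw [incidence_apply]
  rcases h with ⟨rfl, rfl⟩ | ⟨rfl, rfl⟩ <;> simp [hs, hy]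

/-- The Laplacian matrix of the subgraph `F`, with the rows in `S` replaced by those of the
identity matrix. -/
noncomputable def groundedLaplacian (G : Multigraph V E) (S : Finset V) (F : Finset E) :
    Matrix V V ℝ :=
  Matrix.of fun v => if v ∈ S then Pi.single v 1
    else fun w => ∑ e ∈ F, G.incidence v e * G.incidence w e

theorem groundedLaplacian_of_mem (G : Multigraph V E) {S : Finset V} (F : Finset E) {v : V}
    (hv : v ∈ S) : G.groundedLaplacian S F v = Pi.single v 1 :=
  if_pos hv

theorem groundedLaplacian_of_notMem (G : Multigraph V E) {S : Finset V} (F : Finset E) {v : V}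
    (hv : v ∉ S) : G.groundedLaplacian S F v
      = fun w => ∑ e ∈ F, G.incidence v e * G.incidence w e :=
  if_neg hv

open Classical in
/-- Edges between grounded vertices do not matter. -/
theorem groundedLaplacian_erase (G : Multigraph V E) {S : Finset V} {F : Finset E} {e : E}
    {s y : V} (he : e ∈ F) (hj : G.Joins e s y) (hs : s ∈ S) (hy : y ∈ S) :
    G.groundedLaplacian S (F.erase e) = G.groundedLaplacian S F := by
  ext v w
  by_cases hvS : v ∈ S
  · rw [groundedLaplacian_of_mem G _ hvS, groundedLaplacian_of_mem G _ hvS]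
  · have hvs : v ≠ s := fun h => hvS (h ▸ hs)
    have hvy : v ≠ y := fun h => hvS (h ▸ hy)
    rw [groundedLaplacian_of_notMem G _ hvS, groundedLaplacian_of_notMem G _ hvS]
    simp only
    rw [← Finset.sum_erase_add _ _ he, hj.incidence_eq_zero hvs hvy, zero_mul, add_zero]

theorem groundedLaplacian_insert (G : Multigraph V E) (S : Finset V) (F : Finset E) (y : V) :
    G.groundedLaplacian (insert y S) F
      = (G.groundedLaplacian S F).updateRow y (Pi.single y 1) := by
  ext v w
  by_cases h : v = y
  · subst h
    rw [groundedLaplacian_of_mem G F (Finset.mem_insert_self v S), Matrix.updateRow_self]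
  · rw [Matrix.updateRow_ne h]
    simp [groundedLaplacian, h]

variable [Fintype V]

theorem sum_incidence_mul (G : Multigraph V E) (χ : V → ℝ) (e : E) :
    ∑ v, G.incidence v e * χ v = χ (G.head e) - χ (G.tail e) := by
  simp [incidence_apply, sub_mul, Finset.sum_sub_distrib]

-- The counterpart of `card_rootedForests_step`. The row of `s` is grounded, so `e` contributes only
-- to row `y`, and the determinant is linear in that row.
open Classical in
theorem det_groundedLaplacian_step (G : Multigraph V E) {S : Finset V} {F : Finset E} {e : E}
    {s y : V} (he : e ∈ F) (hj : G.Joins e s y) (hs : s ∈ S) (hy : y ∉ S) :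
    (G.groundedLaplacian S F).det = (G.groundedLaplacian S (F.erase e)).det
      + (G.groundedLaplacian (insert y S) (F.erase e)).det := by
  have h1 : G.groundedLaplacian S F = (G.groundedLaplacian S (F.erase e)).updateRow y
      (G.groundedLaplacian S (F.erase e) y + (Pi.single y 1 - Pi.single s 1)) := by
    ext v w
    by_cases hv : v = y
    · subst hv
      rw [Matrix.updateRow_self, groundedLaplacian_of_notMem G _ hy,
        groundedLaplacian_of_notMem G _ hy, Pi.add_apply, ← hj.incidence_mul,
        Finset.sum_erase_add _ _ he]
    · rw [Matrix.updateRow_ne hv]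
      by_cases hvS : v ∈ S
      · rw [groundedLaplacian_of_mem G _ hvS, groundedLaplacian_of_mem G _ hvS]
      · have hvs : v ≠ s := fun h => hvS (h ▸ hs)
        rw [groundedLaplacian_of_notMem G _ hvS, groundedLaplacian_of_notMem G _ hvS]
        simp only
        rw [← Finset.sum_erase_add _ _ he, hj.incidence_eq_zero hvs hv, zero_mul, add_zero]
  -- Rows `y` and `s` coincide here, so δ_y − δ_s may be replaced by δ_y in row `y`.
  have h2 : ((G.groundedLaplacian S (F.erase e)).updateRow y (Pi.single s 1)).det = 0 := by
    refine Matrix.det_zero_of_row_eq hj.ne ?_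
    rw [Matrix.updateRow_self, Matrix.updateRow_ne hj.ne, groundedLaplacian_of_mem G _ hs]
  have h3 := Matrix.det_updateRow_add (G.groundedLaplacian S (F.erase e)) y
    (Pi.single y 1 - Pi.single s 1) (Pi.single s 1)
  rw [sub_add_cancel, h2, add_zero] at h3
  rw [h1, Matrix.det_updateRow_add, Matrix.updateRow_eq_self, ← h3, groundedLaplacian_insert]

/-- The matrix-tree theorem for rooted forests. -/
theorem det_groundedLaplacian (G : Multigraph V E) (S : Finset V) (F : Finset E) :
    (G.groundedLaplacian S F).det = (G.rootedForests S F).card := by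
  classical
  refine root_induction G (P := fun S F => (G.groundedLaplacian S F).det
    = (G.rootedForests S F).card) ?_ ?_ S F
  · intro S F hc
    by_cases hS : ∀ v, v ∈ S
    · have h1 : G.groundedLaplacian S F = 1 := by
        ext v w
        rw [groundedLaplacian_of_mem G _ (hS v), Matrix.one_apply, Pi.single_apply]
        simp [eq_comm]
      have h2 : G.rootedForests S F = {∅} := by
        ext T
        rw [mem_rootedForests, Finset.mem_singleton, Finset.eq_univ_iff_forall.2 hS,
          Finset.card_univ]
        constructor
        · rintro ⟨-, h, -⟩
          simpa using h
        · rintro rfl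
          exact ⟨by simp, by simp, fun v => ⟨v, by simp, .refl _⟩⟩
      simp [h1, h2]
    · push Not at hS
      obtain ⟨v, hv⟩ := hS
      have h2 : G.rootedForests S F = ∅ := by
        refine Finset.eq_empty_of_forall_notMem fun T hT => hv ?_
        rw [mem_rootedForests] at hT
        exact hT.2.2.mem_of_closed (fun e he => hc e (hT.1 he)) v
      have h1 : (G.groundedLaplacian S F).det = 0 := by
        rw [← Matrix.exists_mulVec_eq_zero_iff]
        -- No edge of `F` crosses the boundary of `S`, so the indicator of the complement is a
        -- nonzero null vector.
        refine ⟨fun w => if w ∈ S then 0 else 1, fun h => by simpa [hv] using congrFun h v, ?_⟩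
        funext x
        rw [Matrix.mulVec]
        by_cases hx : x ∈ S
        · simp [groundedLaplacian_of_mem G _ hx, hx]
        · rw [groundedLaplacian_of_notMem G _ hx]
          simp only [dotProduct, Finset.sum_mul, Pi.zero_apply]
          rw [Finset.sum_comm]
          refine Finset.sum_eq_zero fun e he => ?_
          have h3 : G.head e ∈ S ↔ G.tail e ∈ S :=
            ⟨hc e he _ _ (G.joins_head_tail e), hc e he _ _ (G.joins_head_tail e).symm⟩
          simp only [mul_assoc, ← Finset.mul_sum, sum_incidence_mul, h3, sub_self, mul_zero]
      simp [h1, h2]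
  · intro S F e s y he hj hs hy ih1 ih2
    rw [det_groundedLaplacian_step G he hj hs hy, card_rootedForests_step G he hj hs hy, ih1]
    push_cast
    congr 1
    convert ih2

end Determinant

/-! ### Cycles and redundant edges. -/

section Cycle

variable {V E : Type*}

/-- An edge of a cycle can be bypassed along the rest of the cycle. -/
theorem HasCycle.exists_joins_reachable {G : Multigraph V E} {F : Set E} (h : G.HasCycle F) :
    ∃ e ∈ F, ∃ x y, G.Joins e x y ∧ (G.adjacency (F \ {e})).Reachable x y := by
  obtain ⟨n, v, c, -, hc, h⟩ := h
  refine ⟨c (Fin.last n), (h _).1, v (Fin.last n), v 0, ?_, ?_⟩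
  · simpa using (h (Fin.last n)).2
  · have key : ∀ k : ℕ, ∀ hk : k < n + 1,
        (G.adjacency (F \ {c (Fin.last n)})).Reachable (v 0) (v ⟨k, hk⟩) := by
      intro k
      induction k with
      | zero => exact fun _ => .refl _
      | succ k ih =>
        intro hk
        have hk' : k < n + 1 := by omega
        have hj := (h ⟨k, hk'⟩).2
        have hs : (⟨k, hk'⟩ + 1 : Fin (n + 1)) = ⟨k + 1, hk⟩ := by
          ext
          rw [Fin.val_add_one_of_lt (Fin.lt_def.2 (by simp; omega))]
        rw [hs] at hj
        refine (ih hk').trans (hj.reachable ⟨(h _).1, fun hcc => ?_⟩)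
        have := congrArg Fin.val (hc hcc)
        simp at this
        omega
    exact (key n (Nat.lt_succ_self n)).symm

/-- A path together with a further edge that joins its ends is a cycle. -/
theorem HasCycle.of_reachable {G : Multigraph V E} {F : Set E} {e : E} {x y : V} (he : e ∈ F)
    (hj : G.Joins e x y) (h : (G.adjacency (F \ {e})).Reachable x y) : G.HasCycle F := by
  classical
  obtain ⟨p, hp⟩ := h.exists_isPath
  have hadj : ∀ i : ℕ, i < p.length →
      ∃ f ∈ F \ {e}, G.Joins f (p.getVert i) (p.getVert (i + 1)) :=
    fun i hi => p.adj_getVert_succ hi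
  choose f hf hfj using hadj
  have hinj : ∀ i j, i ≤ p.length → j ≤ p.length → p.getVert i = p.getVert j → i = j :=
    fun i j hi hj h => hp.getVert_injOn hi hj h
  -- The path supplies all edges but the last; `e` closes the cycle at index `p.length`, where `i +
  -- 1` wraps to `0`.
  refine ⟨p.length, fun i => p.getVert i, fun i => if hi : (i : ℕ) < p.length then f i hi else e,
    ?_, ?_, ?_⟩
  · intro i j hij
    exact Fin.ext (hinj i j (by omega) (by omega) hij)
  · intro i j hij
    simp only at hij
    split_ifs at hij with hi hj hj
    · have h1 := hfj i hi
      rw [hij] at h1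
      rcases (hfj j hj).eq_or_eq h1 with ⟨h2, -⟩ | ⟨h2, h3⟩
      · exact Fin.ext (hinj _ _ (by omega) (by omega) h2)
      -- One edge traversed in opposite directions would force `i = j + 1` and `i + 1 = j`.
      · have := hinj _ _ (by omega) (by omega) h2
        have := hinj _ _ (by omega) (by omega) h3
        omega
    · exact absurd hij (hf i hi).2
    · exact absurd hij.symm (hf j hj).2
    · exact Fin.ext (by omega)
  · intro i
    simp only
    split_ifs with hi
    · refine ⟨(hf i hi).1, ?_⟩
      rw [Fin.val_add_one_of_lt (Fin.lt_def.2 (by simpa using hi))]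
      exact hfj i hi
    · have : i = Fin.last _ := Fin.ext (by simp; omega)
      subst this
      refine ⟨he, ?_⟩
      simpa using hj.symm

theorem HasCycle.mono {G : Multigraph V E} {F F' : Set E} (h : G.HasCycle F) (hF : F ⊆ F') :
    G.HasCycle F' := by
  obtain ⟨n, v, c, hv, hc, h⟩ := h
  exact ⟨n, v, c, hv, hc, fun i => ⟨hF (h i).1, (h i).2⟩⟩

end Cycle

/-! ### Counting forests by edges, components and separated vertices. -/

section Count

variable {V E : Type*}

open Classical in
theorem kappa_eq_card [Fintype E] (G : Multigraph V E) (r : ℕ) :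
    G.kappa r = ({F : Finset E | G.IsForest r (F : Set E)} : Finset (Finset E)).card := by
  rw [kappa, ← Set.ncard_coe_finset, ← Set.ncard_image_of_injective _ Finset.coe_injective]
  congr 1
  ext F
  simp only [Set.mem_ofPred_eq, Finset.coe_filter, Finset.mem_univ, true_and, Set.mem_image]
  constructor
  · exact fun h => ⟨F.toFinite.toFinset, by simpa using h, by simp⟩
  · rintro ⟨T, hT, rfl⟩
    exact hT

variable [Fintype V]

/-- Removing `e` and adding the root `y` preserves all three hypotheses and the sum of the
cardinalities. -/
theorem card_add_card_of_not_hasCycle {G : Multigraph V E} {F : Finset E} {S : Finset V}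
    (hF : ¬ G.HasCycle (F : Set E)) (h : G.Spans (F : Set E) (S : Set V))
    (hS : ∀ s ∈ S, ∀ t ∈ S, (G.adjacency (F : Set E)).Reachable s t → s = t) :
    F.card + S.card = Fintype.card V := by
  classical
  revert hF h hS
  refine root_induction G (P := fun S F => ¬ G.HasCycle (F : Set E) →
    G.Spans (F : Set E) (S : Set V) →
    (∀ s ∈ S, ∀ t ∈ S, (G.adjacency (F : Set E)).Reachable s t → s = t) →
    F.card + S.card = Fintype.card V) ?_ ?_ S F
  · intro S F hc _ h hS
    have hV : ∀ v, v ∈ S := fun v => h.mem_of_closed hc v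
    have hF : F = ∅ := by
      refine Finset.eq_empty_of_forall_notMem fun e he => ?_
      exact G.head_ne_tail e (hS _ (hV _) _ (hV _)
        ((G.joins_head_tail e).reachable (Finset.mem_coe.2 he)))
    simp [hF, Finset.eq_univ_iff_forall.2 hV]
  · intro S F e s y he hj hs hy _ ih hF h hS
    have hsub : (F : Set E) \ {e} ⊆ F := Set.sdiff_subset
    have hmono := G.adjacency_mono hsub
    have hyt : ∀ t ∈ S, ¬ (G.adjacency ((F : Set E) \ {e})).Reachable t y := by
      -- If `t` reached `y` without `e`, then `t` and `s` would be connected roots, hence equal, and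
      -- `e` would close a cycle.
      intro t ht hr
      have : s = t := hS s hs t ht ((hj.reachable (Finset.mem_coe.2 he)).trans
        (hr.mono hmono).symm)
      subst this
      exact hF (HasCycle.of_reachable (Finset.mem_coe.2 he) hj hr)
    have h1 := ih (fun hc => hF (hc.mono (by simp)))
      (by simpa using h.diff_insert hj hs) (by
        intro a ha b hb hr
        rw [Finset.coe_erase] at hr
        rcases Finset.mem_insert.1 ha with rfl | ha' <;>
          rcases Finset.mem_insert.1 hb with rfl | hb'
        · rfl
        · exact absurd hr.symm (hyt b hb')
        · exact absurd hr (hyt a ha')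
        · exact hS a ha' b hb' (hr.mono hmono))
    rw [Finset.card_erase_of_mem he, Finset.card_insert_of_notMem hy] at h1
    have := Finset.card_pos.2 ⟨e, he⟩
    omega

/-- A choice of one root in every component. -/
theorem exists_transversal (G : Multigraph V E) (F : Set E) :
    ∃ S : Finset V, G.Spans F (S : Set V) ∧
      (∀ s ∈ S, ∀ t ∈ S, (G.adjacency F).Reachable s t → s = t) ∧
      S.card = Nat.card (G.adjacency F).ConnectedComponent := by
  classical
  have hout : ∀ C : (G.adjacency F).ConnectedComponent,
      (G.adjacency F).connectedComponentMk (Quot.out C) = C := fun C => Quot.out_eq C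
  have : Fintype (G.adjacency F).ConnectedComponent := Fintype.ofFinite _
  refine ⟨Finset.univ.image fun C : (G.adjacency F).ConnectedComponent => Quot.out C, ?_, ?_, ?_⟩
  · intro v
    refine ⟨Quot.out ((G.adjacency F).connectedComponentMk v),
      Finset.mem_coe.2 (Finset.mem_image_of_mem _ (Finset.mem_univ _)), ?_⟩
    exact SimpleGraph.ConnectedComponent.exact (hout _)
  · intro s hs t ht h
    simp only [Finset.mem_image, Finset.mem_univ, true_and] at hs ht
    obtain ⟨C, rfl⟩ := hs
    obtain ⟨D, rfl⟩ := ht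
    have := SimpleGraph.ConnectedComponent.sound h
    rw [hout, hout] at this
    rw [this]
  · rw [Finset.card_image_of_injective _ (fun C D h => by
      rw [← hout C, ← hout D]; exact congrArg _ h),
      Finset.card_univ, Nat.card_eq_fintype_card]

theorem Spans.card_connectedComponent_le {G : Multigraph V E} {F : Set E} {S : Finset V}
    (h : G.Spans F (S : Set V)) : Nat.card (G.adjacency F).ConnectedComponent ≤ S.card := by
  rw [← Nat.card_eq_finsetCard S]
  refine Nat.card_le_card_of_surjective
    (fun s : S => (G.adjacency F).connectedComponentMk s) ?_
  intro C
  induction C using SimpleGraph.ConnectedComponent.ind with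
  | h v =>
    obtain ⟨s, hs, hr⟩ := h v
    exact ⟨⟨s, hs⟩, SimpleGraph.ConnectedComponent.sound hr⟩

/-- The cycle-free edge sets are those in which the number of components is the least possible. -/
theorem not_hasCycle_iff (G : Multigraph V E) (F : Finset E) : ¬ G.HasCycle (F : Set E) ↔
    F.card + Nat.card (G.adjacency (F : Set E)).ConnectedComponent = Fintype.card V := by
  classical
  obtain ⟨S, hsp, hS, hc⟩ := G.exists_transversal (F : Set E)
  rw [← hc]
  refine ⟨fun hF => card_add_card_of_not_hasCycle hF hsp hS, fun hcard hcyc => ?_⟩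
  obtain ⟨e, he, x, y, hj, hr⟩ := hcyc.exists_joins_reachable
  -- A cycle edge can be deleted without losing spanning, which leaves fewer edges than
  -- `Spans.card_le` allows.
  have hsp' : G.Spans ((F.erase e : Finset E) : Set E) (S : Set V) := by
    intro v
    obtain ⟨s, hs, hsv⟩ := hsp v
    refine ⟨s, hs, of_reachable (p := fun w => (G.adjacency _).Reachable s w) ?_ hsv (.refl _)⟩
    rw [Finset.coe_erase]
    intro f hf a b hfj hsa
    by_cases hfe : f = e
    · subst hfe
      rcases hj.eq_or_eq hfj with ⟨rfl, rfl⟩ | ⟨rfl, rfl⟩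
      · exact hsa.trans hr
      · exact hsa.trans hr.symm
    · exact hsa.trans (hfj.reachable ⟨hf, hfe⟩)
  have h1 := hsp'.card_le
  rw [Finset.card_erase_of_mem he] at h1
  have := Finset.card_pos.2 ⟨e, he⟩
  omega

theorem isForest_iff (G : Multigraph V E) (r : ℕ) (F : Finset E) : G.IsForest r (F : Set E) ↔
    F.card + r = Fintype.card V ∧
      Nat.card (G.adjacency (F : Set E)).ConnectedComponent = r := by
  rw [IsForest, not_hasCycle_iff]
  constructor
  · rintro ⟨h, rfl⟩
    exact ⟨h, rfl⟩
  · rintro ⟨h, rfl⟩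
    exact ⟨h, rfl⟩

/-- A rooted forest is a forest with one component for each root. -/
theorem mem_rootedForests_univ [Fintype E] {G : Multigraph V E} {S : Finset V} {F : Finset E} :
    F ∈ G.rootedForests S Finset.univ ↔ G.IsForest S.card (F : Set E) ∧
      ∀ s ∈ S, ∀ t ∈ S, (G.adjacency (F : Set E)).Reachable s t → s = t := by
  classical
  rw [mem_rootedForests, isForest_iff]
  constructor
  · rintro ⟨-, hc, hsp⟩
    obtain ⟨T, hT, -, hTc⟩ := G.exists_transversal (F : Set E)
    have h1 := hT.card_le
    have h2 := hsp.card_connectedComponent_le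
    refine ⟨⟨hc, by omega⟩, fun s hs t ht h => ?_⟩
    by_contra hne
    have hsp' : G.Spans (F : Set E) ((S.erase t : Finset V) : Set V) := by
      intro v
      obtain ⟨u, hu, hr⟩ := hsp v
      by_cases hut : u = t
      · subst hut
        exact ⟨s, by simp [hne]; exact hs, h.trans hr⟩
      · exact ⟨u, by simp [hut]; exact hu, hr⟩
    have h3 := hsp'.card_le
    rw [Finset.card_erase_of_mem ht] at h3
    have := Finset.card_pos.2 ⟨t, ht⟩
    omega
  · rintro ⟨⟨hc, hcc⟩, hS⟩
    refine ⟨Finset.subset_univ _, hc, fun v => ?_⟩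
    have hinj : Function.Injective
        fun s : S => (G.adjacency (F : Set E)).connectedComponentMk (s : V) := fun s t h =>
      Subtype.ext (hS s s.2 t t.2 (SimpleGraph.ConnectedComponent.exact h))
    -- There are as many roots as components, so distinct components for distinct roots means a root
    -- in every component.
    have hbij := (Nat.bijective_iff_injective_and_card _).2 ⟨hinj, by rw [hcc]; simp⟩
    obtain ⟨s, hs⟩ := hbij.2 ((G.adjacency (F : Set E)).connectedComponentMk v)
    exact ⟨s, s.2, SimpleGraph.ConnectedComponent.exact hs⟩

theorem kappa_one_eq [Fintype E] (G : Multigraph V E) (q : V) :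
    G.kappa 1 = (G.rootedForests {q} Finset.univ).card := by
  classical
  rw [kappa_eq_card]
  congr 1
  ext F
  rw [mem_rootedForests_univ]
  simp

open Classical in
/-- The two-forests that separate `v` from `q`. -/
noncomputable def separatingForests [Fintype E] (G : Multigraph V E) (q v : V) :
    Finset (Finset E) :=
  {F | G.IsForest 2 (F : Set E) ∧ ¬ (G.adjacency (F : Set E)).Reachable q v}

theorem mem_separatingForests [Fintype E] {G : Multigraph V E} {q v : V} {F : Finset E} :
    F ∈ G.separatingForests q v ↔
      G.IsForest 2 (F : Set E) ∧ ¬ (G.adjacency (F : Set E)).Reachable q v := by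
  simp [separatingForests]

theorem separatingForests_eq [DecidableEq V] [Fintype E] (G : Multigraph V E) {q v : V}
    (h : v ≠ q) : G.separatingForests q v = G.rootedForests {v, q} Finset.univ := by
  ext F
  rw [mem_rootedForests_univ, mem_separatingForests, Finset.card_pair h]
  simp only [Finset.mem_insert, Finset.mem_singleton]
  refine and_congr_right fun _ => ⟨fun hr => ?_,
    fun hS hr => h (hS _ (.inr rfl) _ (.inl rfl) hr).symm⟩
  rintro s (rfl | rfl) t (rfl | rfl) hst
  · rfl
  · exact absurd hst.symm hr
  · exact absurd hst hr
  · rfl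

open Classical in
/-- The component of a two-forest that avoids `q` has one more vertex than edges. -/
theorem card_vertices_eq_card_edges_add_one [Fintype E] {G : Multigraph V E} {F : Finset E}
    (hF : G.IsForest 2 (F : Set E)) (q : V) :
    ({v | ¬ (G.adjacency (F : Set E)).Reachable q v} : Finset V).card
      = {e ∈ F | ¬ (G.adjacency (F : Set E)).Reachable q (G.head e)}.card + 1 := by
  obtain ⟨a, ha⟩ : ∃ a, ¬ (G.adjacency (F : Set E)).Reachable q a := by
    by_contra! h
    have h1 : G.Spans (F : Set E) (({q} : Finset V) : Set V) := fun v => ⟨q, by simp, h v⟩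
    have := h1.card_connectedComponent_le
    rw [hF.2] at this
    simp at this
  have hqa : a ≠ q := by
    rintro rfl
    exact ha (.refl _)
  have hmem : F ∈ G.rootedForests {a, q} Finset.univ := by
    rw [← separatingForests_eq G hqa, mem_separatingForests]
    exact ⟨hF, ha⟩
  rw [mem_rootedForests, Finset.card_pair hqa] at hmem
  obtain ⟨-, hc, hsp⟩ := hmem
  -- For a union `p` of components lying within reach of `b`, take as roots `b` and everything
  -- outside `p`: then `Spans.card_le` bounds the vertices in `p` by its edges plus one. Applied to
  -- both sides of the two-forest, this must be sharp, since the edge total is two less than the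
  -- vertex total.
  have key : ∀ p : V → Prop, (∀ e ∈ F, ∀ x y, G.Joins e x y → p x → p y) → ∀ b,
      (∀ v, p v → (G.adjacency (F : Set E)).Reachable b v) →
      Fintype.card V ≤ {e ∈ F | p (G.head e)}.card + (({v | ¬ p v} : Finset V).card + 1) := by
    intro p hp b hb
    refine (Spans.card_le (G := G) (S := insert b ({v | ¬ p v} : Finset V)) ?_).trans
      (Nat.add_le_add_left (Finset.card_insert_le _ _) _)
    intro v
    by_cases hv : p v
    · refine ⟨b, by simp, ?_⟩
      have h1 : ∀ w, (G.adjacency (F : Set E)).Reachable v w → p w ∧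
          (G.adjacency (({e ∈ F | p (G.head e)} : Finset E) : Set E)).Reachable v w := by
        intro w hw
        refine of_reachable (p := fun w => p w ∧ (G.adjacency
          (({e ∈ F | p (G.head e)} : Finset E) : Set E)).Reachable v w) ?_ hw ⟨hv, .refl _⟩
        rintro e he x y hj ⟨hx, hvx⟩
        have hy := hp e he x y hj hx
        refine ⟨hy, hvx.trans (hj.reachable ?_)⟩
        rw [Finset.mem_coe, Finset.mem_filter]
        refine ⟨he, ?_⟩
        rcases hj with ⟨rfl, rfl⟩ | ⟨rfl, rfl⟩
        · exact hx
        · exact hy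
      exact (h1 b (hb v hv).symm).2.symm
    · exact ⟨v, by simp [hv], .refl _⟩
  have hcl : ∀ e ∈ F, ∀ x y, G.Joins e x y → (G.adjacency (F : Set E)).Reachable q x →
      (G.adjacency (F : Set E)).Reachable q y :=
    fun e he x y hj hx => hx.trans (hj.reachable he)
  have k1 := key (fun v => (G.adjacency (F : Set E)).Reachable q v) hcl q fun v hv => hv
  have k2 := key (fun v => ¬ (G.adjacency (F : Set E)).Reachable q v)
    (fun e he x y hj hx hy => hx (hcl e he y x hj.symm hy)) a (by
      intro v hv
      obtain ⟨s, hs, hr⟩ := hsp v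
      simp only [Finset.coe_insert, Finset.coe_singleton, Set.mem_insert_iff,
        Set.mem_singleton_iff] at hs
      rcases hs with rfl | rfl
      · exact hr
      · exact absurd hr hv)
  have c1 : {e ∈ F | (G.adjacency (F : Set E)).Reachable q (G.head e)}.card
      + {e ∈ F | ¬ (G.adjacency (F : Set E)).Reachable q (G.head e)}.card = F.card :=
    Finset.card_filter_add_card_filter_not _
  have c2 : ({v | (G.adjacency (F : Set E)).Reachable q v} : Finset V).card
      + ({v | ¬ (G.adjacency (F : Set E)).Reachable q v} : Finset V).card = Fintype.card V :=
    Finset.card_filter_add_card_filter_not _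
  have k3 : Fintype.card V ≤ {e ∈ F | ¬ (G.adjacency (F : Set E)).Reachable q (G.head e)}.card
      + (({v | (G.adjacency (F : Set E)).Reachable q v} : Finset V).card + 1) := by
    simp only [not_not] at k2
    convert k2
  have k4 : Fintype.card V ≤ {e ∈ F | (G.adjacency (F : Set E)).Reachable q (G.head e)}.card
      + (({v | ¬ (G.adjacency (F : Set E)).Reachable q v} : Finset V).card + 1) := by
    convert k1
  omega

open Classical in
/-- The number of two-forests, by summing over two-forests the number of vertices minus the number
of edges of the component that avoids `q`. -/
theorem kappa_two_add_sum [Fintype E] (G : Multigraph V E) (q : V) :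
    G.kappa 2 + ∑ e : E, {F ∈ G.separatingForests q (G.head e) | e ∈ F}.card
      = ∑ v : V, (G.separatingForests q v).card := by
  have hE : ∀ e : E, {F ∈ G.separatingForests q (G.head e) | e ∈ F}.card
      = ∑ F ∈ ({F | G.IsForest 2 (F : Set E)} : Finset (Finset E)),
        if ¬ (G.adjacency (F : Set E)).Reachable q (G.head e) ∧ e ∈ F then 1 else 0 := by
    intro e
    rw [← Finset.card_filter, separatingForests, Finset.filter_filter, Finset.filter_filter]
    simp only [and_assoc]
  have hV : ∀ v : V, (G.separatingForests q v).card
      = ∑ F ∈ ({F | G.IsForest 2 (F : Set E)} : Finset (Finset E)),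
        if ¬ (G.adjacency (F : Set E)).Reachable q v then 1 else 0 := by
    intro v
    rw [← Finset.card_filter, Finset.filter_filter, separatingForests]
  simp only [hE, hV]
  rw [kappa_eq_card]
  rw [Finset.sum_comm, Finset.sum_comm (s := (Finset.univ : Finset V)), Finset.card_eq_sum_ones,
    ← Finset.sum_add_distrib]
  refine Finset.sum_congr rfl fun F hF => ?_
  have := card_vertices_eq_card_edges_add_one (Finset.mem_filter.1 hF).2 q
  rw [← Finset.card_filter, ← Finset.card_filter, this, add_comm]
  congr 2
  ext e
  simp [and_comm]

end Count

/-! ### Green functions, Cramer's rule and the resistance formula. -/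

section Green

/-- Cramer's rule for a unit vector. -/
theorem det_updateRow_single_of_mulVec_eq {V : Type*} [Fintype V] [DecidableEq V]
    {A : Matrix V V ℝ} {z : V → ℝ} {i : V} (h : A.mulVec z = Pi.single i 1) :
    (A.updateRow i (Pi.single i 1)).det = A.det * z i := by
  have h1 := congrArg (A.adjugate.mulVec · i) h
  simp only [Matrix.mulVec_mulVec, Matrix.adjugate_mul, Matrix.smul_mulVec, Matrix.one_mulVec,
    Pi.smul_apply, smul_eq_mul] at h1
  rw [h1, Matrix.mulVec_single_one, Matrix.col_apply, Matrix.adjugate_apply]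

variable {V E : Type*} [Fintype E]

theorem Connected.spans {G : Multigraph V E} (hG : G.Connected) {S : Finset V} {q : V}
    (hq : q ∈ S) : G.Spans ((Finset.univ : Finset E) : Set E) (S : Set V) := by
  intro v
  rw [Finset.coe_univ]
  exact ⟨q, hq, hG.preconnected q v⟩

variable [Fintype V]

theorem Connected.kappa_one_pos {G : Multigraph V E} (hG : G.Connected) : 0 < G.kappa 1 := by
  obtain ⟨q⟩ := hG.nonempty
  rw [kappa_one_eq G q]
  exact (hG.spans (Finset.mem_singleton_self q)).card_rootedForests_pos

variable [DecidableEq V]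

theorem laplacian_mulVec_apply (G : Multigraph V E) (φ : V → ℝ) (v : V) :
    G.laplacian.mulVec φ v = ∑ e, G.incidence v e * (φ (G.head e) - φ (G.tail e)) := by
  simp only [laplacian, ← Matrix.mulVec_mulVec, ← sum_incidence_mul]
  rfl

theorem groundedLaplacian_mulVec (G : Multigraph V E) {S : Finset V} (φ : V → ℝ) (v : V) :
    (G.groundedLaplacian S Finset.univ).mulVec φ v
      = if v ∈ S then φ v else G.laplacian.mulVec φ v := by
  rw [Matrix.mulVec]
  split_ifs with h
  · simp [groundedLaplacian_of_mem G _ h]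
  · rw [groundedLaplacian_of_notMem G _ h]
    rfl

/-- `g` is the Green function of `G` grounded at `q`: the potential `g x` is driven by one unit of
current that enters at `x` and exits at `q`, and vanishes at `q`. -/
structure IsGreen (G : Multigraph V E) (q : V) (g : V → V → ℝ) : Prop where
  isUnitPotential : ∀ x, G.IsUnitPotential x q (g x)
  apply_ground : ∀ x, g x q = 0

theorem Connected.exists_isGreen {G : Multigraph V E} (hG : G.Connected) (q : V) :
    ∃ g, G.IsGreen q g := by
  choose φ hφ using fun x => hG.exists_isUnitPotential x q
  refine ⟨fun x v => φ x v - φ x q, fun x => ?_, fun x => sub_self _⟩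
  rw [IsUnitPotential, ← (hφ x : G.laplacian.mulVec (φ x) = _)]
  funext v
  simp [laplacian_mulVec_apply]

namespace IsGreen

variable {G : Multigraph V E} {q : V} {g : V → V → ℝ}

theorem symm (h : G.IsGreen q g) (x y : V) : g x y = g y x := by
  -- The term from δ_q drops out because `g x` vanishes at `q`.
  have key : ∀ x y, dotProduct (g x) (G.laplacian.mulVec (g y)) = g x y := by
    intro x y
    rw [h.isUnitPotential y, dotProduct_sub]
    simp [h.apply_ground]
  have hsymm : G.laplacian.transpose = G.laplacian := by
    simp [laplacian, Matrix.transpose_mul]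
  rw [← key, ← key y x, Matrix.dotProduct_mulVec, ← Matrix.mulVec_transpose, hsymm,
    dotProduct_comm]

theorem ground_apply (h : G.IsGreen q g) (x : V) : g q x = 0 := by
  rw [h.symm, h.apply_ground]

theorem effRes_ground (h : G.IsGreen q g) (x : V) : G.effRes x q = g x x := by
  rw [(h.isUnitPotential x).effRes_eq, h.apply_ground, sub_zero]

/-- Superposition: in `g x - g y` the currents leaving at `q` cancel. -/
theorem effRes_eq (h : G.IsGreen q g) (x y : V) : G.effRes x y = g x x + g y y - 2 * g x y := by
  have : G.IsUnitPotential x y (g x - g y) := by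
    rw [IsUnitPotential, Matrix.mulVec_sub, h.isUnitPotential x, h.isUnitPotential y]
    abel
  rw [this.effRes_eq, Pi.sub_apply, Pi.sub_apply, h.symm y x]
  ring

theorem groundedLaplacian_mulVec_eq (h : G.IsGreen q g) {x : V} (hx : x ≠ q) :
    (G.groundedLaplacian {q} Finset.univ).mulVec (g x) = Pi.single x 1 := by
  funext v
  rw [groundedLaplacian_mulVec, h.isUnitPotential x]
  by_cases hv : v = q
  · subst hv
    simp [h.apply_ground, hx.symm]
  · simp [hv]

/-- Grounding `x` as well replaces one row by a unit vector, and Cramer's rule reads off the ratio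
of determinants. -/
theorem card_rootedForests_pair (h : G.IsGreen q g) {x : V} (hx : x ≠ q) :
    ((G.rootedForests {x, q} Finset.univ).card : ℝ) = G.kappa 1 * g x x := by
  rw [kappa_one_eq G q, ← det_groundedLaplacian, ← det_groundedLaplacian,
    groundedLaplacian_insert,
    det_updateRow_single_of_mulVec_eq (h.groundedLaplacian_mulVec_eq hx)]

/-- Cramer's rule applied twice, grounding `x` and then `y`. -/
theorem card_rootedForests_triple (h : G.IsGreen q g) (hG : G.Connected) {x y : V} (hx : x ≠ q)
    (hy : y ≠ q) (hxy : x ≠ y) :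
    ((G.rootedForests {y, x, q} Finset.univ).card : ℝ)
      = G.kappa 1 * (g x x * g y y - g x y ^ 2) := by
  have hpos : (0 : ℝ) < (G.rootedForests {x, q} Finset.univ).card := by
    exact_mod_cast (hG.spans (q := q) (by simp)).card_rootedForests_pos
  have hpair := h.card_rootedForests_pair hx
  have hgx : g x x ≠ 0 := by
    intro h0
    rw [hpair, h0, mul_zero] at hpos
    exact lt_irrefl _ hpos
  -- The Green function grounded at both `x` and `q`: the multiple of `g x` is chosen to cancel the
  -- value of `g y` at `x`.
  have hz : (G.groundedLaplacian {x, q} Finset.univ).mulVec (g y - (g x y / g x x) • g x)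
      = Pi.single y 1 := by
    funext v
    rw [groundedLaplacian_mulVec, Matrix.mulVec_sub, Matrix.mulVec_smul, h.isUnitPotential x,
      h.isUnitPotential y]
    by_cases hvx : v = x
    · subst hvx
      simp [hxy, h.symm y v, hgx]
    · by_cases hvq : v = q
      · subst hvq
        simp [h.apply_ground, hy.symm]
      · simp [hvx, hvq]
  rw [← det_groundedLaplacian, groundedLaplacian_insert, det_updateRow_single_of_mulVec_eq hz,
    det_groundedLaplacian, hpair]
  simp only [Pi.sub_apply, Pi.smul_apply, smul_eq_mul]
  field_simp

theorem card_separatingForests (h : G.IsGreen q g) (v : V) :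
    ((G.separatingForests q v).card : ℝ) = G.kappa 1 * g v v := by
  by_cases hv : v = q
  · subst hv
    simp [separatingForests, h.apply_ground]
  · rw [separatingForests_eq G hv, h.card_rootedForests_pair hv]

open Classical in
theorem card_separatingForests_mem (h : G.IsGreen q g) (hG : G.Connected) (e : E) :
    ({F ∈ G.separatingForests q (G.head e) | e ∈ F}.card : ℝ)
      = G.kappa 1 * (g (G.head e) (G.head e) * g (G.tail e) (G.tail e)
          - g (G.head e) (G.tail e) ^ 2) := by
  by_cases hx : G.head e = q
  · simp [hx, h.ground_apply, separatingForests]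
  by_cases hy : G.tail e = q
  · rw [hy, h.apply_ground, h.apply_ground, Finset.filter_false_of_mem]
    · simp
    · intro F hF he
      exact (mem_separatingForests.1 hF).2
        (hy ▸ (G.joins_head_tail e).symm.reachable (Finset.mem_coe.2 he))
  have hxy := G.head_ne_tail e
  rw [← h.card_rootedForests_triple hG hx hy hxy]
  -- Contracting `e` makes its tail a root. With both ends grounded `e` no longer affects the
  -- determinant, so it can be restored to the edge set.
  rw [separatingForests_eq G hx,
    card_rootedForests_mem G (Finset.mem_univ e) (G.joins_head_tail e) (by simp)
      (by simp [hxy.symm, hy]), ← det_groundedLaplacian,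
    groundedLaplacian_erase G (Finset.mem_univ e) (G.joins_head_tail e) (by simp) (by simp),
    det_groundedLaplacian]
  congr!

theorem kappa_two_div (h : G.IsGreen q g) (hG : G.Connected) :
    (G.kappa 2 : ℝ) / G.kappa 1 = ∑ v, g v v - ∑ e, (g (G.head e) (G.head e) *
      g (G.tail e) (G.tail e) - g (G.head e) (G.tail e) ^ 2) := by
  have hκ : (G.kappa 1 : ℝ) ≠ 0 := by exact_mod_cast hG.kappa_one_pos.ne'
  have h1 := congrArg (Nat.cast (R := ℝ)) (kappa_two_add_sum G q)
  push_cast at h1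
  simp only [h.card_separatingForests_mem hG, h.card_separatingForests, ← Finset.mul_sum] at h1
  rw [div_eq_iff hκ]
  linarith

/-- The trace of the Green function as a sum over the edges. -/
theorem sum_apply_self (h : G.IsGreen q g) : ∑ v, g v v
    = ∑ e, (g (G.head e) (G.head e) * (g (G.head e) (G.head e) - g (G.head e) (G.tail e))
      + g (G.tail e) (G.tail e) * (g (G.tail e) (G.tail e) - g (G.head e) (G.tail e))) := by
  have h1 : ∀ v, g v v = ∑ e, G.incidence v e * (g v v * (g v (G.head e) - g v (G.tail e))) := by
    intro v
    -- The Laplacian entry is 1 for `v ≠ q`; at `q` the factor `g q q` vanishes.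
    have h2 : g v v * G.laplacian.mulVec (g v) v = g v v := by
      rw [h.isUnitPotential v]
      by_cases hv : v = q
      · subst hv
        simp [h.apply_ground]
      · simp [hv]
    rw [laplacian_mulVec_apply, Finset.mul_sum] at h2
    exact h2.symm.trans (Finset.sum_congr rfl fun e _ => by ring)
  rw [Finset.sum_congr rfl fun v _ => h1 v, Finset.sum_comm]
  refine Finset.sum_congr rfl fun e _ => ?_
  rw [sum_incidence_mul, h.symm (G.tail e) (G.head e)]
  ring

theorem kappa_two_div_eq (h : G.IsGreen q g) (hG : G.Connected) :
    (G.kappa 2 : ℝ) / G.kappa 1 = 1 / 4 * ∑ e : E, G.effRes (G.head e) (G.tail e) ^ 2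
      + 3 / 4 * ∑ e : E, (G.effRes (G.head e) q - G.effRes (G.tail e) q) ^ 2 := by
  rw [h.kappa_two_div hG, h.sum_apply_self, ← Finset.sum_sub_distrib, Finset.mul_sum,
    Finset.mul_sum, ← Finset.sum_add_distrib]
  refine Finset.sum_congr rfl fun e _ => ?_
  rw [h.effRes_ground, h.effRes_ground, h.effRes_eq]
  -- With a = g(x,x), b = g(y,y), c = g(x,y), both sides equal a² + b² + c² − ab − ac − bc.
  ring

end IsGreen

end Green

end Multigraph

theorem theoremC {V E : Type*} [Fintype V] [DecidableEq V] [Fintype E]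
    (G : Multigraph V E) (hG : G.Connected) :
    0 < G.kappa 1 ∧
    (∀ q : V, (G.kappa 2 : ℝ) / (G.kappa 1 : ℝ)
      = 1 / 4 * ∑ e : E, G.effRes (G.head e) (G.tail e) ^ 2
        + 3 / 4 * ∑ e : E, (G.effRes (G.head e) q - G.effRes (G.tail e) q) ^ 2) ∧
    (∀ q q' : V, G.gammaConst q = G.gammaConst q') ∧
    (∀ q : V, (G.kappa 2 : ℝ) / (G.kappa 1 : ℝ)
      = 3 * G.gammaConst q + 1 / 4 * ∑ e : E, G.effRes (G.head e) (G.tail e) ^ 2) := by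
  have main : ∀ q : V, (G.kappa 2 : ℝ) / (G.kappa 1 : ℝ)
      = 1 / 4 * ∑ e : E, G.effRes (G.head e) (G.tail e) ^ 2
        + 3 / 4 * ∑ e : E, (G.effRes (G.head e) q - G.effRes (G.tail e) q) ^ 2 := fun q =>
    (hG.exists_isGreen q).choose_spec.kappa_two_div_eq hG
  refine ⟨hG.kappa_one_pos, main, fun q q' => ?_, fun q => ?_⟩
  · have h := main q
    rw [main q'] at h
    rw [Multigraph.gammaConst, Multigraph.gammaConst]
    linarith
  · rw [main q, Multigraph.gammaConst]
    ring
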